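/- Let $f$ be an analytic function on an open set $\Omega\subseteq\mathbb C$ and let $z_1\neq z_2$ be points of $\Omega$. By a contour in $\Omega$ we mean a closed piecewise $C^1$ loop, or a finite family of such loops, that is contained in $\Omega$ and has winding number $0$ about every point of $\mathbb C\setminus\Omega$; it encircles a point off it if its winding number about that point is $1$. (In particular, every counterclockwise simple closed piecewise $C^1$ loop that is contained in $\Omega$ together with its inside is such a contour, and it encircles exactly the points of its inside.) For every $z\in\Omega$ there is a contour in $\Omega$ encircling $z$, $z_1$ and $z_2$. The Cauchy integrals $$a_n(z_1,z_2)=\frac1{2\pi i\,(z_2-z_1)}\int_{\mathcal C}\frac{f(w)\,dw}{(w-z_1)^n(w-z_2)^{n+1}},\qquad a_n(z_2,z_1)=\frac1{2\pi i\,(z_1-z_2)}\int_{\mathcal C}\frac{f(w)\,dw}{(w-z_2)^n(w-z_1)^{n+1}},\qquad n=0,1,2,\dots,$$ have the same value for every contour $\mathcal C$ in $\Omega$ that encircles $z_1$ and $z_2$. With these coefficients, for every $z\in\Omega$ and every $N\ge 0$, $$f(z)=\sum_{n=0}^{N-1}\bigl[a_n(z_1,z_2)(z-z_1)+a_n(z_2,z_1)(z-z_2)\bigr](z-z_1)^n(z-z_2)^n+r_N(z_1,z_2;z),$$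 where, for every contour $\mathcal C$ in $\Omega$ that encircles $z$, $z_1$ and $z_2$, $$r_N(z_1,z_2;z)=\frac{1}{2\pi i}\int_{\mathcal C}\frac{f(w)\,dw}{(w-z_1)^N(w-z_2)^N(w-z)}\,(z-z_1)^N(z-z_2)^N .$$ For every $z$ inside the Cassini oval $$O_{z_1,z_2}=\{z\in\Omega:\ |(z-z_1)(z-z_2)|<r\},\qquad r=\inf_{w\in\mathbb C\setminus\Omega}|(w-z_1)(w-z_2)|\in(0,\infty]\quad(r=\infty\text{ if }\Omega=\mathbb C),$$ the series $$\sum_{n=0}^{\infty}\bigl[a_n(z_1,z_2)(z-z_1)+a_n(z_2,z_1)(z-z_2)\bigr](z-z_1)^n(z-z_2)^n$$ converges (absolutely) to $f(z)$. In particular, if $f$ is entire ($\Omega=\mathbb C$), it converges to $f(z)$ for all $z\in\mathbb C$. -/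

import Mathlib

open scoped ENNReal

noncomputable section

/-- A closed piecewise continuously differentiable path in `ℂ`, parametrized by `[0, 1]`
(only the values on `[0, 1]` matter): there are `0 = t 0 ≤ t 1 ≤ … ≤ t m = 1` such that the path
is `C¹` (one-sidedly at the end points) on each `[t i, t (i + 1)]`. -/
structure PiecewiseC1Loop where
  toFun : ℝ → ℂ
  closed : toFun 0 = toFun 1
  piecewise : ∃ (m : ℕ) (t : ℕ → ℝ), Monotone t ∧ t 0 = 0 ∧ t m = 1 ∧
    ∀ i < m, ContDiffOn ℝ 1 toFun (Set.Icc (t i) (t (i + 1)))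

/-- The trace of a closed path. -/
def PiecewiseC1Loop.trace (γ : PiecewiseC1Loop) : Set ℂ :=
  γ.toFun '' Set.Icc 0 1

/-- The integral `∫_γ g(w) dw`. -/
def PiecewiseC1Loop.integral (γ : PiecewiseC1Loop) (g : ℂ → ℂ) : ℂ :=
  ∫ t in (0 : ℝ)..1, g (γ.toFun t) * deriv γ.toFun t

/-- A contour: a finite family of closed piecewise `C¹` paths. A single loop `γ` is the
contour `[γ]`. -/
abbrev Contour : Type := List PiecewiseC1Loop

namespace Contour

/-- The trace of a contour: the union of the traces of its loops. -/
def trace (C : Contour) : Set ℂ :=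
  {w | ∃ γ ∈ C, w ∈ γ.trace}

/-- The contour integral `∫_C g(w) dw`: the sum of the integrals along the loops. -/
def integral (C : Contour) (g : ℂ → ℂ) : ℂ :=
  (C.map fun γ => γ.integral g).sum

/-- The winding number of the contour `C` about a point `p` off its trace. -/
def windingNumber (C : Contour) (p : ℂ) : ℂ :=
  1 / (2 * Real.pi * Complex.I) * C.integral fun w => 1 / (w - p)

/-- `C` goes once around `p` in the counterclockwise direction. -/
def Encircles (C : Contour) (p : ℂ) : Prop :=
  p ∉ C.trace ∧ C.windingNumber p = 1

/-- `C` lies in `Ω` and does not go around any point outside `Ω`. For a simple closed loop this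
says that the loop and its inside are contained in `Ω`. -/
def LiesInWithInside (C : Contour) (Ω : Set ℂ) : Prop :=
  C.trace ⊆ Ω ∧ ∀ p ∉ Ω, C.windingNumber p = 0

end Contour

/-- The Cauchy integral
`1 / (2πi (z₂ - z₁)) ∫_C f(w) / ((w - z₁)ⁿ (w - z₂)ⁿ⁺¹) dw` for `aₙ(z₁, z₂)`. -/
def twoPointCoeff (f : ℂ → ℂ) (C : Contour) (z₁ z₂ : ℂ) (n : ℕ) : ℂ :=
  1 / (2 * Real.pi * Complex.I * (z₂ - z₁)) *
    C.integral fun w => f w / ((w - z₁) ^ n * (w - z₂) ^ (n + 1))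

/-- The Cauchy integral
`1 / (2πi) ∫_C f(w) / ((w - z₁)ᴺ (w - z₂)ᴺ (w - z)) dw (z - z₁)ᴺ (z - z₂)ᴺ` for `r_N(z₁, z₂; z)`. -/
def twoPointRemainder (f : ℂ → ℂ) (C : Contour) (z₁ z₂ : ℂ) (N : ℕ) (z : ℂ) : ℂ :=
  1 / (2 * Real.pi * Complex.I) *
    (C.integral fun w => f w / ((w - z₁) ^ N * (w - z₂) ^ N * (w - z))) *
    ((z - z₁) ^ N * (z - z₂) ^ N)

/-- `inf {|(w - z₁)(w - z₂)| : w ∉ Ω}`, which is `∞` when `Ω` is the whole plane. -/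
def cassiniParameter (Ω : Set ℂ) (z₁ z₂ : ℂ) : ℝ≥0∞ :=
  ⨅ w ∈ Ωᶜ, ‖(w - z₁) * (w - z₂)‖ₑ

/-- The inside of the Cassini oval. -/
def cassiniOval (Ω : Set ℂ) (z₁ z₂ : ℂ) : Set ℂ :=
  {z | z ∈ Ω ∧ ‖(z - z₁) * (z - z₂)‖ₑ < cassiniParameter Ω z₁ z₂}

end

/-! Write q(w) = (w - z₁)(w - z₂) and let S be the second divided difference `secondSlope`, so that
f is its linear interpolant at z₁, z₂ plus q · S f. Iterating gives the finite expansion at once: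
the coefficients are read off from the values of Sⁿf at z₁ and z₂, and the remainder is qᴺ · Sᴺf. No
contour enters.

The Cauchy integrals are then identified in `integral_div_pow_mul_pow`. Substituting f = interpolant
+ q · S f lowers the exponent by one, because the interpolant contributes only integrals of 1 / ∏ (w
- a) with at least two factors and all poles encircled; these vanish by partial fractions. What is
left is Cauchy's formula for Sᴺf in its homology form, proved by Dixon's argument. Independence of
the contour follows.

Convergence does not use the remainder. Put u = w - (z₁ + z₂)/2 and d = (z₁ - z₂)/2, so that q = u²
- d². Where |q| < R, f splits as e(u²) + u · o(u²) with e, o holomorphic on the disc of radius R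
about d², and S acts on e and o as the ordinary difference quotient at d²
(`secondSlope_eq_even_add_odd`). The two-point expansion is thus the Taylor series of e at d² plus u
times that of o. In ℂ, `HasSum` amounts to absolute convergence. -/

open Set Filter Topology MeasureTheory

/-! ### Integration along piecewise C¹ loops. -/

namespace PiecewiseC1Loop

variable (γ : PiecewiseC1Loop)

lemma regularity_aux (φ : ℝ → ℂ) (t : ℕ → ℝ) (ht : Monotone t) (m : ℕ)
    (h : ∀ i < m, ContDiffOn ℝ 1 φ (Icc (t i) (t (i + 1)))) :
    ContinuousOn φ (Icc (t 0) (t m)) ∧ IntervalIntegrable (deriv φ) volume (t 0) (t m) ∧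
      ∀ x ∈ Icc (t 0) (t m), x ∉ t '' Iic m → DifferentiableAt ℝ φ x := by
  induction m with
  | zero =>
    refine ⟨by simp, by simp, fun x hx hxt => (hxt ⟨0, by simp, ?_⟩).elim⟩
    exact le_antisymm hx.1 hx.2
  | succ m ih =>
    obtain ⟨hc, hi, hd⟩ := ih fun i hi => h i (by omega)
    have h0 : t 0 ≤ t m := ht (Nat.zero_le m)
    have h1 : t m ≤ t (m + 1) := ht (Nat.le_succ m)
    have hm := h m (Nat.lt_succ_self m)
    rw [← Icc_union_Icc_eq_Icc h0 h1]
    refine ⟨hc.union_of_isClosed hm.continuousOn isClosed_Icc isClosed_Icc, hi.trans ?_, ?_⟩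
    · rcases h1.eq_or_lt with h1 | h1
      · simp [h1]
      have hcont : ContinuousOn (derivWithin φ (Icc (t m) (t (m + 1)))) (Icc (t m) (t (m + 1))) :=
        hm.continuousOn_derivWithin (uniqueDiffOn_Icc h1) le_rfl
      -- On the open interval `deriv` agrees with the continuous one-sided derivative; its values at
      -- the break points are irrelevant.
      rw [intervalIntegrable_iff_integrableOn_Ioo_of_le h1.le]
      refine ((hcont.integrableOn_Icc).mono_set Ioo_subset_Icc_self).congr_fun
        (fun x hx => ?_) measurableSet_Ioo
      exact derivWithin_of_mem_nhds (Icc_mem_nhds hx.1 hx.2)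
    · rintro x hx hxt
      rcases hx with hx | hx
      · exact hd x hx fun ⟨i, hi, hix⟩ => hxt ⟨i, le_trans hi (Nat.le_succ m), hix⟩
      · have hl : t m ≠ x := fun e => hxt ⟨m, by simp, e⟩
        have hr : t (m + 1) ≠ x := fun e => hxt ⟨m + 1, by simp, e⟩
        exact (hm.differentiableOn one_ne_zero).differentiableAt
          (Icc_mem_nhds (lt_of_le_of_ne hx.1 hl) (lt_of_le_of_ne hx.2 hr.symm))

lemma continuousOn : ContinuousOn γ.toFun (Icc 0 1) := by
  obtain ⟨m, t, ht, h0, h1, h⟩ := γ.piecewise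
  have := (regularity_aux γ.toFun t ht m h).1
  rwa [h0, h1] at this

lemma intervalIntegrable_deriv : IntervalIntegrable (deriv γ.toFun) volume 0 1 := by
  obtain ⟨m, t, ht, h0, h1, h⟩ := γ.piecewise
  have := (regularity_aux γ.toFun t ht m h).2.1
  rwa [h0, h1] at this

lemma exists_countable_differentiableAt :
    ∃ s : Set ℝ, s.Countable ∧ ∀ x ∈ Icc (0 : ℝ) 1 \ s, DifferentiableAt ℝ γ.toFun x := by
  obtain ⟨m, t, ht, h0, h1, h⟩ := γ.piecewise
  have := (regularity_aux γ.toFun t ht m h).2.2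
  rw [h0, h1] at this
  exact ⟨t '' Iic m, (to_countable _).image t, fun x hx => this x hx.1 hx.2⟩

lemma isCompact_trace : IsCompact γ.trace :=
  isCompact_Icc.image_of_continuousOn γ.continuousOn

lemma mem_trace {t : ℝ} (ht : t ∈ Icc (0 : ℝ) 1) : γ.toFun t ∈ γ.trace :=
  mem_image_of_mem _ ht

variable {γ}

lemma continuousOn_comp {g : ℂ → ℂ} (hg : ContinuousOn g γ.trace) :
    ContinuousOn (fun t => g (γ.toFun t)) (Icc 0 1) :=
  hg.comp γ.continuousOn fun _ ht => γ.mem_trace ht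

lemma intervalIntegrable {g : ℂ → ℂ} (hg : ContinuousOn g γ.trace) :
    IntervalIntegrable (fun t => g (γ.toFun t) * deriv γ.toFun t) volume 0 1 := by
  refine γ.intervalIntegrable_deriv.continuousOn_mul ?_
  rw [uIcc_of_le zero_le_one]
  exact continuousOn_comp hg

lemma integral_congr {g h : ℂ → ℂ} (hgh : EqOn g h γ.trace) : γ.integral g = γ.integral h := by
  refine intervalIntegral.integral_congr fun t ht => ?_
  rw [uIcc_of_le zero_le_one] at ht
  simp only [hgh (γ.mem_trace ht)]

lemma integral_add {g h : ℂ → ℂ} (hg : ContinuousOn g γ.trace) (hh : ContinuousOn h γ.trace) :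
    γ.integral (fun w => g w + h w) = γ.integral g + γ.integral h := by
  simp only [integral, add_mul]
  exact intervalIntegral.integral_add (intervalIntegrable hg) (intervalIntegrable hh)

lemma integral_const_mul (c : ℂ) (g : ℂ → ℂ) :
    γ.integral (fun w => c * g w) = c * γ.integral g := by
  simp only [integral, mul_assoc]
  exact intervalIntegral.integral_const_mul _ _

lemma norm_integral_le {g : ℂ → ℂ} {M : ℝ} (hM : ∀ w ∈ γ.trace, ‖g w‖ ≤ M) :
    ‖γ.integral g‖ ≤ M * ∫ t in (0 : ℝ)..1, ‖deriv γ.toFun t‖ := by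
  rw [← intervalIntegral.integral_const_mul]
  refine intervalIntegral.norm_integral_le_of_norm_le zero_le_one (ae_of_all _ fun t ht => ?_)
    (γ.intervalIntegrable_deriv.norm.const_mul M)
  rw [norm_mul]
  gcongr
  exact hM _ (γ.mem_trace (Ioc_subset_Icc_self ht))

/-- A continuous function with a primitive near the trace of a closed path has integral zero. -/
lemma integral_eq_zero_of_hasDerivAt {g G : ℂ → ℂ} (hg : ContinuousOn g γ.trace)
    (hG : ∀ w ∈ γ.trace, HasDerivAt G (g w) w) : γ.integral g = 0 := by
  obtain ⟨s, hs, hd⟩ := γ.exists_countable_differentiableAt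
  -- This form of the fundamental theorem of calculus tolerates the countably many break points.
  have key := integral_eq_of_hasDerivAt_off_countable_of_le (fun t => G (γ.toFun t))
    (fun t => g (γ.toFun t) * deriv γ.toFun t) zero_le_one hs
    (continuousOn_comp fun w hw => (hG w hw).continuousAt.continuousWithinAt)
    (fun t ht => (hG _ (γ.mem_trace (Ioo_subset_Icc_self ht.1))).comp_of_eq t
      (hd t ⟨Ioo_subset_Icc_self ht.1, ht.2⟩).hasDerivAt rfl) (intervalIntegrable hg)
  rw [integral, key, γ.closed, sub_self]

/-- Holomorphic dependence of a path integral on a parameter. -/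
lemma differentiableOn_integral {U : Set ℂ} (hU : IsOpen U) {F : ℂ → ℂ → ℂ}
    (hc : ∀ z ∈ U, ContinuousOn (F z) γ.trace)
    (hd : ∀ w ∈ γ.trace, DifferentiableOn ℂ (fun z => F z w) U)
    (hb : ∀ z₀ ∈ U, ∃ M, ∀ᶠ z in 𝓝 z₀, ∀ w ∈ γ.trace, ‖F z w‖ ≤ M) :
    DifferentiableOn ℂ (fun z => γ.integral (F z)) U := by
  intro z₀ hz₀
  obtain ⟨M, hM⟩ := hb z₀ hz₀
  obtain ⟨ε, hε, hball⟩ := Metric.eventually_nhds_iff_ball.1 (hM.and (hU.eventually_mem hz₀))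
  have hIoc : Ioc (0 : ℝ) 1 ⊆ Icc 0 1 := Ioc_subset_Icc_self
  have hsub : ∀ z ∈ Metric.ball z₀ (ε / 2), Metric.ball z (ε / 2) ⊆ Metric.ball z₀ ε := by
    intro z hz
    refine Metric.ball_subset_ball' ?_
    have := Metric.mem_ball.1 hz
    linarith
  have hmeas : ∀ z ∈ U, AEStronglyMeasurable (fun t => F z (γ.toFun t))
      (volume.restrict (Ioc (0 : ℝ) 1)) := fun z hz =>
    ((continuousOn_comp (hc z hz)).mono hIoc).aestronglyMeasurable measurableSet_Ioc
  have hint : ∀ z ∈ U, Integrable (fun t => F z (γ.toFun t) * deriv γ.toFun t)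
      (volume.restrict (Ioc (0 : ℝ) 1)) := fun z hz =>
    (intervalIntegrable_iff_integrableOn_Ioc_of_le zero_le_one).1 (intervalIntegrable (hc z hz))
  have hγ : IntegrableOn (deriv γ.toFun) (Ioc 0 1) :=
    (intervalIntegrable_iff_integrableOn_Ioc_of_le zero_le_one).1 γ.intervalIntegrable_deriv
  have hdz : ∀ w ∈ γ.trace, ∀ z ∈ Metric.ball z₀ ε, DifferentiableAt ℂ (fun z => F z w) z :=
    fun w hw z hz => (hd w hw).differentiableAt (hU.mem_nhds (hball z hz).2)
  -- Cauchy's estimate on the circle of radius ε / 4 about z, which stays in the ball where M bounds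
  -- F.
  have hderiv : ∀ w ∈ γ.trace, ∀ z ∈ Metric.ball z₀ (ε / 2),
      ‖deriv (fun z => F z w) z‖ ≤ M / (ε / 4) := by
    intro w hw z hz
    refine Complex.norm_deriv_le_of_forall_mem_sphere_norm_le (by positivity) ?_ fun x hx => ?_
    · refine DifferentiableOn.diffContOnCl fun x hx => ?_
      rw [closure_ball _ (by positivity)] at hx
      exact (hdz w hw x (hsub z hz (Metric.closedBall_subset_ball (by linarith) hx)
        )).differentiableWithinAt
    · refine (hball x (hsub z hz ?_)).1 w hw
      exact Metric.sphere_subset_closedBall.trans (Metric.closedBall_subset_ball (by linarith)) hx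
  have key := hasDerivAt_integral_of_dominated_loc_of_deriv_le
    (μ := volume.restrict (Ioc (0 : ℝ) 1)) (𝕜 := ℂ) (x₀ := z₀)
    (F := fun z t => F z (γ.toFun t) * deriv γ.toFun t)
    (F' := fun z t => deriv (fun z => F z (γ.toFun t)) z * deriv γ.toFun t)
    (bound := fun t => M / (ε / 4) * ‖deriv γ.toFun t‖)
    (Metric.ball_mem_nhds z₀ (half_pos hε))
    ((hU.eventually_mem hz₀).mono fun z hz => (hint z hz).aestronglyMeasurable) (hint z₀ hz₀)
    ?_ ?_ (hγ.norm.const_mul _) ?_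
  · have h2 := key.2.differentiableAt.differentiableWithinAt (s := U)
    simpa only [integral, intervalIntegral.integral_of_le zero_le_one] using h2
  · refine AEStronglyMeasurable.mul ?_ hγ.aestronglyMeasurable
    -- The z-derivative is measurable in t as a pointwise limit of difference quotients along a
    -- sequence in U.
    have hseq : Tendsto (fun n : ℕ => z₀ + ((ε / 2 / (n + 1) : ℝ) : ℂ)) atTop (𝓝[≠] z₀) := by
      refine tendsto_nhdsWithin_iff.2 ⟨?_, Eventually.of_forall fun n => ?_⟩
      · have h0 : Tendsto (fun n : ℕ => ε / 2 / ((n : ℝ) + 1)) atTop (𝓝 0) :=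
          tendsto_const_nhds.div_atTop
            (tendsto_natCast_atTop_atTop.atTop_add tendsto_const_nhds)
        simpa using ((Complex.continuous_ofReal.tendsto 0).comp h0).const_add z₀
      · have : (ε / 2 / (n + 1) : ℝ) ≠ 0 := by positivity
        simpa only [mem_compl_iff, mem_singleton_iff, add_eq_left, Complex.ofReal_eq_zero] using this
    have hmem : ∀ n : ℕ, z₀ + ((ε / 2 / (n + 1) : ℝ) : ℂ) ∈ U := by
      intro n
      refine (hball _ ?_).2
      rw [Metric.mem_ball, dist_eq_norm, add_sub_cancel_left, Complex.norm_real, Real.norm_eq_abs,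
        abs_of_pos (by positivity), div_lt_iff₀ (by positivity)]
      nlinarith [Nat.cast_nonneg (α := ℝ) n]
    refine aestronglyMeasurable_of_tendsto_ae atTop
      (f := fun (n : ℕ) t => slope (fun z => F z (γ.toFun t)) z₀
        (z₀ + ((ε / 2 / (n + 1) : ℝ) : ℂ))) (fun n => ?_) ?_
    · simp only [slope_def_field, div_eq_mul_inv]
      exact ((hmeas _ (hmem n)).sub (hmeas _ hz₀)).mul aestronglyMeasurable_const
    · refine (ae_restrict_mem measurableSet_Ioc).mono fun t ht => ?_
      exact (hasDerivAt_iff_tendsto_slope.1 (hdz _ (γ.mem_trace (hIoc ht)) z₀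
        (Metric.mem_ball_self hε)).hasDerivAt).comp hseq
  · refine (ae_restrict_mem measurableSet_Ioc).mono fun t ht z hz => ?_
    rw [norm_mul]
    gcongr
    exact hderiv _ (γ.mem_trace (hIoc ht)) z hz
  · refine (ae_restrict_mem measurableSet_Ioc).mono fun t ht z hz => ?_
    exact (hdz _ (γ.mem_trace (hIoc ht)) z
      (Metric.ball_subset_ball (by linarith) hz)).hasDerivAt.mul_const _

end PiecewiseC1Loop

/-! ### Contours, Cauchy-type integrals and winding numbers. -/

namespace Contour

variable {C : Contour} {g h : ℂ → ℂ}

lemma trace_subset_trace {γ : PiecewiseC1Loop} (hγ : γ ∈ C) : γ.trace ⊆ C.trace :=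
  fun _ hw => ⟨γ, hγ, hw⟩

@[simp] lemma trace_cons (γ : PiecewiseC1Loop) (C : Contour) :
    Contour.trace (γ :: C) = γ.trace ∪ C.trace := by
  ext w
  simp [Contour.trace]

@[simp] lemma integral_cons (γ : PiecewiseC1Loop) (C : Contour) (g : ℂ → ℂ) :
    Contour.integral (γ :: C) g = γ.integral g + C.integral g := by
  simp [Contour.integral]

@[simp] lemma integral_nil (g : ℂ → ℂ) : Contour.integral [] g = 0 := by
  simp [Contour.integral]

lemma isCompact_trace (C : Contour) : IsCompact C.trace := by
  induction C with
  | nil => simp [Contour.trace]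
  | cons γ C ih =>
    rw [trace_cons]
    exact γ.isCompact_trace.union ih

lemma integral_congr (hgh : EqOn g h C.trace) : C.integral g = C.integral h := by
  unfold Contour.integral
  congr 1
  exact List.map_congr_left fun γ hγ =>
    PiecewiseC1Loop.integral_congr (hgh.mono (trace_subset_trace hγ))

lemma integral_add (hg : ContinuousOn g C.trace) (hh : ContinuousOn h C.trace) :
    C.integral (fun w => g w + h w) = C.integral g + C.integral h := by
  induction C with
  | nil => simp
  | cons γ C ih =>
    rw [trace_cons] at hg hh
    simp only [integral_cons, ih (hg.mono subset_union_right) (hh.mono subset_union_right),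
      PiecewiseC1Loop.integral_add (hg.mono subset_union_left) (hh.mono subset_union_left)]
    ring

lemma integral_const_mul (c : ℂ) (g : ℂ → ℂ) :
    C.integral (fun w => c * g w) = c * C.integral g := by
  induction C with
  | nil => simp
  | cons γ C ih => simp only [integral_cons, ih, PiecewiseC1Loop.integral_const_mul, mul_add]

lemma integral_sub (hg : ContinuousOn g C.trace) (hh : ContinuousOn h C.trace) :
    C.integral (fun w => g w - h w) = C.integral g - C.integral h := by
  have := integral_add (h := fun w => -1 * h w) hg (continuousOn_const.mul hh)
  rw [integral_const_mul] at this
  simpa [sub_eq_add_neg] using this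

lemma integral_eq_zero_of_hasDerivAt {G : ℂ → ℂ} (hg : ContinuousOn g C.trace)
    (hG : ∀ w ∈ C.trace, HasDerivAt G (g w) w) : C.integral g = 0 :=
  List.sum_eq_zero fun x hx => by
    obtain ⟨γ, hγ, rfl⟩ := List.mem_map.1 hx
    exact PiecewiseC1Loop.integral_eq_zero_of_hasDerivAt (hg.mono (trace_subset_trace hγ))
      fun w hw => hG w (trace_subset_trace hγ hw)

/-- L is the total length of the loops; the bound serves to let Cauchy-type integrals decay at
infinity. -/
lemma exists_norm_integral_le (C : Contour) : ∃ L : ℝ, 0 ≤ L ∧ ∀ (g : ℂ → ℂ) (M : ℝ),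
    (∀ w ∈ C.trace, ‖g w‖ ≤ M) → ‖C.integral g‖ ≤ M * L := by
  induction C with
  | nil => exact ⟨0, le_rfl, by simp⟩
  | cons γ C ih =>
    obtain ⟨L, hL, h⟩ := ih
    refine ⟨(∫ t in (0 : ℝ)..1, ‖deriv γ.toFun t‖) + L, add_nonneg
      (intervalIntegral.integral_nonneg zero_le_one fun _ _ => norm_nonneg _) hL, fun g M hM => ?_⟩
    rw [integral_cons, mul_add]
    rw [trace_cons] at hM
    exact (norm_add_le _ _).trans (add_le_add
      (PiecewiseC1Loop.norm_integral_le fun w hw => hM w (Or.inl hw))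
      (h g M fun w hw => hM w (Or.inr hw)))

lemma differentiableOn_integral {U : Set ℂ} (hU : IsOpen U) {F : ℂ → ℂ → ℂ}
    (hc : ∀ z ∈ U, ContinuousOn (F z) C.trace)
    (hd : ∀ w ∈ C.trace, DifferentiableOn ℂ (fun z => F z w) U)
    (hb : ∀ z₀ ∈ U, ∃ M, ∀ᶠ z in 𝓝 z₀, ∀ w ∈ C.trace, ‖F z w‖ ≤ M) :
    DifferentiableOn ℂ (fun z => C.integral (F z)) U := by
  induction C with
  | nil => simp
  | cons γ C ih =>
    simp only [trace_cons] at hc hd hb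
    simp only [integral_cons]
    refine (PiecewiseC1Loop.differentiableOn_integral hU
      (fun z hz => (hc z hz).mono subset_union_left) (fun w hw => hd w (Or.inl hw))
      fun z hz => (hb z hz).imp fun M hM => hM.mono fun z hz w hw => hz w (Or.inl hw)).fun_add
      (ih (fun z hz => (hc z hz).mono subset_union_right) (fun w hw => hd w (Or.inr hw))
      fun z hz => (hb z hz).imp fun M hM => hM.mono fun z hz w hw => hz w (Or.inr hw))

lemma continuousOn_div_sub {z : ℂ} (hg : ContinuousOn g C.trace) (hz : z ∉ C.trace) :
    ContinuousOn (fun w => g w / (w - z)) C.trace :=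
  hg.div (by fun_prop) fun _ hw => sub_ne_zero.2 (ne_of_mem_of_not_mem hw hz)

/-- Cauchy-type integrals are holomorphic off the trace. -/
lemma differentiableOn_cauchyIntegral (hg : ContinuousOn g C.trace) :
    DifferentiableOn ℂ (fun z => C.integral fun w => g w / (w - z)) C.traceᶜ := by
  refine differentiableOn_integral C.isCompact_trace.isClosed.isOpen_compl
    (fun z hz => continuousOn_div_sub hg hz) (fun w hw => ?_) fun z₀ hz₀ => ?_
  · refine DifferentiableOn.div (by fun_prop) (by fun_prop) fun z hz => ?_
    exact sub_ne_zero.2 (ne_of_mem_of_not_mem hw hz)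
  · obtain ⟨M, hM⟩ := C.isCompact_trace.exists_bound_of_continuousOn hg
    obtain ⟨ε, hε, hball⟩ := Metric.isOpen_iff.1 C.isCompact_trace.isClosed.isOpen_compl z₀ hz₀
    refine ⟨M / (ε / 2), Filter.mem_of_superset (Metric.ball_mem_nhds z₀ (half_pos hε))
      fun z hz w hw => ?_⟩
    have hdist : ε ≤ dist w z₀ := not_lt.1 fun h => hball (Metric.mem_ball.2 h) hw
    have h2 : ε / 2 ≤ ‖w - z‖ := by
      have := dist_triangle w z z₀
      rw [Metric.mem_ball] at hz
      rw [← dist_eq_norm]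
      linarith
    rw [norm_div]
    exact div_le_div₀ ((norm_nonneg _).trans (hM w hw)) (hM w hw) (half_pos hε) h2

/-- Cauchy-type integrals vanish at infinity. -/
lemma tendsto_cauchyIntegral (hg : ContinuousOn g C.trace) :
    Tendsto (fun z => C.integral fun w => g w / (w - z)) (cocompact ℂ) (𝓝 0) := by
  obtain ⟨M, hM⟩ := C.isCompact_trace.exists_bound_of_continuousOn hg
  obtain ⟨R, hR⟩ := C.isCompact_trace.isBounded.exists_norm_le
  obtain ⟨L, hL, hCL⟩ := C.exists_norm_integral_le
  have hlim : Tendsto (fun z : ℂ => M / (‖z‖ - R) * L) (cocompact ℂ) (𝓝 0) := by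
    have : Tendsto (fun z : ℂ => ‖z‖ - R) (cocompact ℂ) atTop :=
      tendsto_atTop_add_const_right _ _ tendsto_norm_cocompact_atTop
    simpa using (tendsto_const_nhds.div_atTop this).mul_const L
  refine squeeze_zero_norm' ?_ hlim
  filter_upwards [tendsto_norm_cocompact_atTop.eventually_gt_atTop R] with z hz
  refine hCL _ _ fun w hw => ?_
  rw [norm_div]
  refine div_le_div₀ ((norm_nonneg _).trans (hM w hw)) (hM w hw) (by linarith) ?_
  have := norm_sub_norm_le z w
  rw [norm_sub_rev] at this
  linarith [hR w hw]

/-- The integral of `1 / (w - z)`, as a function of `z`, is locally constant off the trace. -/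
lemma eventually_integral_inv_eq {p : ℂ} (hp : p ∉ C.trace) : ∀ᶠ z in 𝓝 p,
    (C.integral fun w => 1 / (w - z)) = C.integral fun w => 1 / (w - p) := by
  have hopen := C.isCompact_trace.isClosed.isOpen_compl
  obtain ⟨ε, hε, hball⟩ := Metric.isOpen_iff.1 hopen p hp
  refine Filter.mem_of_superset (Metric.ball_mem_nhds p hε) fun z hz => ?_
  have hlt : ∀ w ∈ C.trace, ‖z - p‖ < ‖w - p‖ := fun w hw =>
    (mem_ball_iff_norm.1 hz).trans_le
      (not_lt.1 fun h => hball (mem_ball_iff_norm.2 h) hw)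
  have hzC : z ∉ C.trace := fun h => (hlt z h).false
  change _ = _
  rw [← sub_eq_zero, ← integral_sub (continuousOn_div_sub continuousOn_const hzC)
    (continuousOn_div_sub continuousOn_const hp)]
  -- The difference of the two integrands has the primitive log((w - z)/(w - p)). It is
  -- single-valued on the trace because |z - p| < |w - p| keeps the quotient in the disc of radius 1
  -- about 1.
  refine integral_eq_zero_of_hasDerivAt ((continuousOn_div_sub continuousOn_const hzC).sub
    (continuousOn_div_sub continuousOn_const hp))
    (G := fun w => Complex.log (1 - (z - p) / (w - p))) fun w hw => ?_
  have hwp : w - p ≠ 0 := sub_ne_zero.2 (ne_of_mem_of_not_mem hw hp)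
  have hwz : w - z ≠ 0 := sub_ne_zero.2 (ne_of_mem_of_not_mem hw hzC)
  have hslit : 1 - (z - p) / (w - p) ∈ Complex.slitPlane := by
    refine Complex.mem_slitPlane_of_norm_lt_one (z := -((z - p) / (w - p))) ?_
    rw [norm_neg, norm_div, div_lt_one (norm_pos_iff.2 hwp)]
    exact hlt w hw
  convert! (((hasDerivAt_const w (z - p)).fun_div ((hasDerivAt_id w).sub_const p)
    hwp).const_sub 1).clog hslit using 1
  have h1 : 1 - (z - p) / (w - p) = (w - z) / (w - p) := by field_simp; ring
  simp only [id, h1]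
  field_simp
  ring

/-- Once |z| exceeds every |w| on the trace, log(1 - w/z) is a single-valued primitive of 1/(w - z).
-/
lemma eventually_cocompact_integral_inv_eq_zero (C : Contour) : ∀ᶠ z in cocompact ℂ,
    (C.integral fun w => 1 / (w - z)) = 0 := by
  obtain ⟨R, hR⟩ := C.isCompact_trace.isBounded.exists_norm_le
  filter_upwards [tendsto_norm_cocompact_atTop.eventually_gt_atTop R] with z hz
  have hlt : ∀ w ∈ C.trace, ‖w‖ < ‖z‖ := fun w hw => (hR w hw).trans_lt hz
  have hzC : z ∉ C.trace := fun h => (hlt z h).false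
  refine integral_eq_zero_of_hasDerivAt (continuousOn_div_sub continuousOn_const hzC)
    (G := fun w => Complex.log (1 - w / z)) fun w hw => ?_
  have hz0 : z ≠ 0 := norm_pos_iff.1 ((norm_nonneg w).trans_lt (hlt w hw))
  have hslit : 1 - w / z ∈ Complex.slitPlane := by
    refine Complex.mem_slitPlane_of_norm_lt_one (z := -(w / z)) ?_
    rw [norm_neg, norm_div, div_lt_one (norm_pos_iff.2 hz0)]
    exact hlt w hw
  have hwz : w - z ≠ 0 := sub_ne_zero.2 (ne_of_mem_of_not_mem hw hzC)
  convert! (((hasDerivAt_id w).div_const z).const_sub 1).clog hslit using 1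
  have h1 : 1 - w / z = -(w - z) / z := by field_simp; ring
  simp only [id, h1]
  field_simp

end Contour

/-! ### Difference quotients and Dixon's proof of Cauchy's theorem. -/

lemma dslope_comm {𝕜 E : Type*} [NontriviallyNormedField 𝕜] [NormedAddCommGroup E]
    [NormedSpace 𝕜 E] (g : 𝕜 → E) (a b : 𝕜) : dslope g a b = dslope g b a := by
  rcases eq_or_ne a b with rfl | h
  · rfl
  · rw [dslope_of_ne _ h.symm, dslope_of_ne _ h, slope_comm]

lemma DifferentiableOn.dslope {Ω : Set ℂ} (hΩ : IsOpen Ω) {g : ℂ → ℂ}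
    (hg : DifferentiableOn ℂ g Ω) {a : ℂ} : DifferentiableOn ℂ (dslope g a) Ω := by
  by_cases ha : a ∈ Ω
  · exact (Complex.differentiableOn_dslope (hΩ.mem_nhds ha)).2 hg
  · exact (differentiableOn_dslope_of_notMem ha).2 hg

/-- Difference quotients are bounded near every point, uniformly over a compact set. -/
lemma exists_norm_dslope_le {Ω K : Set ℂ} (hΩ : IsOpen Ω) {g : ℂ → ℂ}
    (hg : DifferentiableOn ℂ g Ω) (hK : IsCompact K) (hKΩ : K ⊆ Ω) {z₀ : ℂ} (hz₀ : z₀ ∈ Ω) :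
    ∃ M, ∀ᶠ z in 𝓝 z₀, ∀ w ∈ K, ‖dslope g z w‖ ≤ M := by
  obtain ⟨ε, hε, hball⟩ := Metric.nhds_basis_closedBall.mem_iff.1 (hΩ.mem_nhds hz₀)
  have hcpt := isCompact_closedBall z₀ ε
  obtain ⟨A, hA⟩ := hK.exists_bound_of_continuousOn (hg.continuousOn.mono hKΩ)
  obtain ⟨B, hB⟩ := hcpt.exists_bound_of_continuousOn (hg.continuousOn.mono hball)
  obtain ⟨D, hD⟩ := hcpt.exists_bound_of_continuousOn ((hg.deriv hΩ).continuousOn.mono hball)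
  -- D comes from the mean value inequality on the convex ball when w is near z₀; the other bound
  -- applies when w is outside it, where |w - z| ≥ ε / 2.
  refine ⟨max D ((A + B) / (ε / 2)), Filter.mem_of_superset
    (Metric.ball_mem_nhds z₀ (half_pos hε)) fun z hz w hw => ?_⟩
  have hzε : z ∈ Metric.closedBall z₀ ε :=
    Metric.ball_subset_closedBall (Metric.ball_subset_ball (by linarith) hz)
  by_cases hwε : w ∈ Metric.closedBall z₀ ε
  · refine le_max_of_le_left ?_
    rcases eq_or_ne w z with rfl | hne
    · rw [dslope_same]
      exact hD w hwε
    · rw [dslope_of_ne _ hne, slope_def_field, norm_div,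
        div_le_iff₀ (norm_pos_iff.2 (sub_ne_zero.2 hne))]
      exact (convex_closedBall z₀ ε).norm_image_sub_le_of_norm_deriv_le
        (fun x hx => hg.differentiableAt (hΩ.mem_nhds (hball hx))) hD hzε hwε
  · refine le_max_of_le_right ?_
    have hdist : ε / 2 ≤ ‖w - z‖ := by
      have h1 : ε < dist w z₀ := not_le.1 hwε
      have h2 := dist_triangle w z z₀
      rw [Metric.mem_ball] at hz
      rw [← dist_eq_norm]
      linarith
    have hne : w ≠ z := fun h => hwε (h ▸ hzε)
    have hAB : ‖g w - g z‖ ≤ A + B := (norm_sub_le _ _).trans (add_le_add (hA w hw) (hB z hzε))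
    rw [dslope_of_ne _ hne, slope_def_field, norm_div]
    exact div_le_div₀ ((norm_nonneg _).trans hAB) hAB (half_pos hε) hdist

namespace Contour

variable {C : Contour} {Ω : Set ℂ} {g : ℂ → ℂ}

lemma windingNumber_mul (C : Contour) (p : ℂ) :
    C.windingNumber p * (2 * Real.pi * Complex.I) = C.integral fun w => 1 / (w - p) := by
  rw [windingNumber]
  field_simp [Complex.two_pi_I_ne_zero]

lemma integral_dslope (hgc : ContinuousOn g C.trace) {z : ℂ}
    (hz : z ∉ C.trace) : C.integral (dslope g z) =
      (C.integral fun w => g w / (w - z)) - g z * C.integral fun w => 1 / (w - z) := by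
  rw [← integral_const_mul, ← integral_sub (h := fun w => g z * (1 / (w - z))) (continuousOn_div_sub hgc hz)
    (continuousOn_const.mul (continuousOn_div_sub continuousOn_const hz))]
  refine integral_congr fun w hw => ?_
  rw [dslope_of_ne _ (ne_of_mem_of_not_mem hw hz), slope_def_field]
  ring

open Classical in
/-- Dixon's form of Cauchy's theorem. -/
theorem LiesInWithInside.integral_dslope_eq_zero (hC : C.LiesInWithInside Ω) (hΩ : IsOpen Ω)
    (hg : DifferentiableOn ℂ g Ω) {z : ℂ} (hz : z ∈ Ω) : C.integral (dslope g z) = 0 := by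
  obtain ⟨hCΩ, hw⟩ := hC
  have hgc : ContinuousOn g C.trace := hg.continuousOn.mono hCΩ
  -- The two formulas agree off the trace wherever the winding number vanishes, in particular near
  -- every point outside Ω and near infinity. Hence h is entire and tends to 0 at infinity, so
  -- Liouville's theorem gives h = 0.
  set h : ℂ → ℂ := fun z => if z ∈ Ω then C.integral (dslope g z) else
    C.integral fun w => g w / (w - z) with hdef
  have heq : ∀ z ∉ C.trace, (C.integral fun w => 1 / (w - z)) = 0 →
      h z = C.integral fun w => g w / (w - z) := by
    intro z hz h0
    simp only [hdef]
    split_ifs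
    · rw [integral_dslope hgc hz, h0, mul_zero, sub_zero]
    · rfl
  have hint : DifferentiableOn ℂ (fun z => C.integral (dslope g z)) Ω := by
    refine differentiableOn_integral hΩ (fun z _ => (hg.dslope hΩ).continuousOn.mono hCΩ)
      (fun w _ => ?_) fun z₀ hz₀ => exists_norm_dslope_le hΩ hg C.isCompact_trace hCΩ hz₀
    -- By symmetry, holomorphy in the base point is holomorphy in the other variable.
    simp only [dslope_comm g _ w]
    exact hg.dslope hΩ
  have hdiff : Differentiable ℂ h := by
    intro z
    by_cases hz : z ∈ Ω
    · refine (hint.differentiableAt (hΩ.mem_nhds hz)).congr_of_eventuallyEq ?_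
      filter_upwards [hΩ.mem_nhds hz] with x hx
      simp only [hdef, if_pos hx]
    · have hzC : z ∉ C.trace := fun h => hz (hCΩ h)
      have hopen := C.isCompact_trace.isClosed.isOpen_compl
      refine ((differentiableOn_cauchyIntegral hgc).differentiableAt
        (hopen.mem_nhds hzC)).congr_of_eventuallyEq ?_
      filter_upwards [hopen.mem_nhds hzC, eventually_integral_inv_eq hzC] with x hx hx0
      refine heq x hx ?_
      rw [hx0, ← windingNumber_mul, hw z hz, zero_mul]
  have hlim : Tendsto h (cocompact ℂ) (𝓝 0) := by
    refine (tendsto_cauchyIntegral hgc).congr' ?_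
    filter_upwards [C.eventually_cocompact_integral_inv_eq_zero,
      C.isCompact_trace.compl_mem_cocompact] with x hx0 hx
    exact (heq x hx hx0).symm
  have := hdiff.apply_eq_of_tendsto_cocompact z hlim
  simpa only [hdef, if_pos hz] using this

/-- **Cauchy's integral formula**, homology version. -/
theorem LiesInWithInside.integral_div_sub (hC : C.LiesInWithInside Ω) (hΩ : IsOpen Ω)
    (hg : DifferentiableOn ℂ g Ω) {z : ℂ} (hz : z ∈ Ω) (hzC : z ∉ C.trace) :
    (C.integral fun w => g w / (w - z)) =
      2 * Real.pi * Complex.I * (C.windingNumber z * g z) := by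
  have := hC.integral_dslope_eq_zero hΩ hg hz
  rw [integral_dslope (hg.continuousOn.mono hC.1) hzC, ← windingNumber_mul, sub_eq_zero] at this
  rw [this]
  ring

end Contour

/-! ### Circles, and existence of encircling contours. -/

/-- The circle of centre `c` and radius `r`, traversed once counterclockwise. -/
noncomputable def PiecewiseC1Loop.circle (c : ℂ) (r : ℝ) : PiecewiseC1Loop where
  toFun t := circleMap c r (2 * Real.pi * t)
  closed := by simp [circleMap]
  piecewise := by
    refine ⟨1, fun i => i, Nat.mono_cast, by simp, by simp, fun i _ => ?_⟩
    exact ((contDiff_circleMap c r).comp (contDiff_const.mul contDiff_id)).contDiffOn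

namespace PiecewiseC1Loop

lemma trace_circle_subset (c : ℂ) {r : ℝ} (hr : 0 ≤ r) :
    (circle c r).trace ⊆ Metric.sphere c r := by
  rintro _ ⟨t, -, rfl⟩
  exact circleMap_mem_sphere c hr _

lemma integral_circle (c : ℂ) (r : ℝ) (g : ℂ → ℂ) :
    (circle c r).integral g = ∮ w in C(c, r), g w := by
  have hd : ∀ t : ℝ, deriv (circle c r).toFun t =
      2 * Real.pi * deriv (circleMap c r) (2 * Real.pi * t) := by
    intro t
    have := ((hasDerivAt_circleMap c r (2 * Real.pi * t)).scomp t
      ((hasDerivAt_id t).const_mul (2 * Real.pi))).deriv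
    rw [deriv_circleMap]
    refine Eq.trans this ?_
    simp
  have := intervalIntegral.smul_integral_comp_mul_left (a := 0) (b := 1)
    (fun θ => deriv (circleMap c r) θ • g (circleMap c r θ)) (2 * Real.pi)
  rw [mul_zero, mul_one] at this
  rw [circleIntegral, ← this, integral, ← intervalIntegral.integral_smul]
  refine intervalIntegral.integral_congr fun t _ => ?_
  simp only [hd, smul_eq_mul, Complex.real_smul]
  simp only [circle]
  push_cast
  ring

lemma integral_circle_inv_center (c : ℂ) {r : ℝ} (hr : 0 < r) :
    (circle c r).integral (fun w => 1 / (w - c)) = 2 * Real.pi * Complex.I := by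
  simp only [integral_circle, one_div]
  exact circleIntegral.integral_sub_inv_of_mem_ball (Metric.mem_ball_self hr)

lemma integral_circle_inv_of_notMem {c p : ℂ} {r : ℝ} (hr : 0 < r)
    (hp : p ∉ Metric.closedBall c r) : (circle c r).integral (fun w => 1 / (w - p)) = 0 := by
  rw [integral_circle]
  have h0 : ∀ w ∈ Metric.closedBall c r, w - p ≠ 0 := fun w hw =>
    sub_ne_zero.2 (ne_of_mem_of_not_mem hw hp)
  refine Complex.circleIntegral_eq_zero_of_differentiable_on_off_countable hr.le
    countable_empty (continuousOn_const.div (by fun_prop) h0) fun w hw => ?_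
  exact (differentiableAt_const _).div (by fun_prop)
    (h0 w (Metric.ball_subset_closedBall hw.1))

end PiecewiseC1Loop

lemma IsOpen.exists_pos_closedBall_subset {Ω : Set ℂ} (hΩ : IsOpen Ω) (S : Finset ℂ)
    (hS : ↑S ⊆ Ω) : ∃ r > 0, ∀ s ∈ S, Metric.closedBall s r ⊆ Ω ∧
      ∀ s' ∈ S, s' ≠ s → s' ∉ Metric.closedBall s r := by
  have h : ∀ᶠ r in 𝓝[>] (0 : ℝ), ∀ s ∈ S, Metric.closedBall s r ⊆ Ω ∧
      ∀ s' ∈ S, s' ≠ s → s' ∉ Metric.closedBall s r := by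
    refine (Finset.eventually_all S).2 fun s hs => ?_
    refine Filter.Eventually.and ?_ ((Finset.eventually_all S).2 fun s' _ => ?_)
    · obtain ⟨ε, hε, hball⟩ := Metric.nhds_basis_closedBall.mem_iff.1 (hΩ.mem_nhds (hS hs))
      filter_upwards [Ioo_mem_nhdsGT hε] with r hr
      exact (Metric.closedBall_subset_closedBall hr.2.le).trans hball
    · by_cases hne : s' = s
      · simp [hne]
      · filter_upwards [Ioo_mem_nhdsGT (dist_pos.2 hne)] with r hr
        intro _ h
        exact absurd (Metric.mem_closedBall.1 h) (not_le.2 hr.2)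
  obtain ⟨r, hr, h0⟩ := (h.and self_mem_nhdsWithin).exists
  exact ⟨r, h0, hr⟩

/-- Small circles about finitely many points of an open set form a contour encircling them. -/
theorem Contour.exists_encircles {Ω : Set ℂ} (hΩ : IsOpen Ω) (S : Finset ℂ) (hS : ↑S ⊆ Ω) :
    ∃ C : Contour, C.LiesInWithInside Ω ∧ ∀ s ∈ S, C.Encircles s := by
  classical
  obtain ⟨r, hr, h⟩ := hΩ.exists_pos_closedBall_subset S hS
  have hint : ∀ g : ℂ → ℂ, Contour.integral (S.toList.map fun s => PiecewiseC1Loop.circle s r) g =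
      ∑ s ∈ S, (PiecewiseC1Loop.circle s r).integral g := by
    intro g
    rw [Contour.integral, List.map_map, ← Finset.sum_map_toList]
    rfl
  have htrace : ∀ w ∈ Contour.trace (S.toList.map fun s => PiecewiseC1Loop.circle s r),
      ∃ s ∈ S, w ∈ Metric.sphere s r := by
    rintro w ⟨γ, hγ, hw⟩
    obtain ⟨s, hs, rfl⟩ := List.mem_map.1 hγ
    exact ⟨s, Finset.mem_toList.1 hs, PiecewiseC1Loop.trace_circle_subset s hr.le hw⟩
  refine ⟨S.toList.map fun s => PiecewiseC1Loop.circle s r, ⟨fun w hw => ?_, fun p hp => ?_⟩,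
    fun s hs => ⟨fun hw => ?_, ?_⟩⟩
  · obtain ⟨s, hs, hw⟩ := htrace w hw
    exact (h s hs).1 (Metric.sphere_subset_closedBall hw)
  · rw [windingNumber, hint, Finset.sum_eq_zero fun s hs =>
      PiecewiseC1Loop.integral_circle_inv_of_notMem hr fun hps => hp ((h s hs).1 hps), mul_zero]
  · obtain ⟨s', hs', hw⟩ := htrace s hw
    rcases eq_or_ne s s' with rfl | hne
    · simp [hr.ne] at hw
    · exact (h s' hs').2 s hs hne (Metric.sphere_subset_closedBall hw)
  · rw [windingNumber, hint, Finset.sum_eq_single_of_mem s hs fun s' hs' hne =>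
      PiecewiseC1Loop.integral_circle_inv_of_notMem hr ((h s' hs').2 s hs hne.symm),
      PiecewiseC1Loop.integral_circle_inv_center s hr, one_div,
      inv_mul_cancel₀ Complex.two_pi_I_ne_zero]

/-! ### Iterated second divided differences. -/

/-- The second divided difference `w ↦ g[w, z₁, z₂]`. -/
noncomputable def secondSlope (z₁ z₂ : ℂ) (g : ℂ → ℂ) : ℂ → ℂ :=
  dslope (dslope g z₁) z₂

lemma DifferentiableOn.secondSlope {Ω : Set ℂ} (hΩ : IsOpen Ω) {g : ℂ → ℂ}
    (hg : DifferentiableOn ℂ g Ω) (z₁ z₂ : ℂ) : DifferentiableOn ℂ (secondSlope z₁ z₂ g) Ω :=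
  (hg.dslope hΩ).dslope hΩ

/-- Newton's interpolation formula at two points, with the linear part in Lagrange form. -/
lemma eq_add_secondSlope {z₁ z₂ : ℂ} (hne : z₁ ≠ z₂) (g : ℂ → ℂ) (w : ℂ) :
    g w = g z₂ / (z₂ - z₁) * (w - z₁) + g z₁ / (z₁ - z₂) * (w - z₂) +
      (w - z₁) * (w - z₂) * secondSlope z₁ z₂ g w := by
  have h1 := sub_smul_dslope g z₁ w
  have h2 := sub_smul_dslope g z₁ z₂
  have h3 := sub_smul_dslope (dslope g z₁) z₂ w
  simp only [smul_eq_mul] at h1 h2 h3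
  have h12 : z₁ - z₂ ≠ 0 := sub_ne_zero.2 hne
  have h21 : z₂ - z₁ ≠ 0 := sub_ne_zero.2 hne.symm
  have hlin : g z₂ / (z₂ - z₁) * (w - z₁) + g z₁ / (z₁ - z₂) * (w - z₂) =
      g z₁ + (w - z₁) * dslope g z₁ z₂ := by
    rw [← neg_sub z₂ z₁]
    field_simp
    linear_combination (-(w - z₁)) * h2
  rw [hlin, secondSlope]
  linear_combination (-1 : ℂ) * h1 - (w - z₁) * h3

lemma eq_sum_add_iterate_secondSlope {z₁ z₂ : ℂ} (hne : z₁ ≠ z₂) (f : ℂ → ℂ) (N : ℕ) (z : ℂ) :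
    f z = ∑ n ∈ Finset.range N,
      ((secondSlope z₁ z₂)^[n] f z₂ / (z₂ - z₁) * (z - z₁) +
        (secondSlope z₁ z₂)^[n] f z₁ / (z₁ - z₂) * (z - z₂)) * ((z - z₁) ^ n * (z - z₂) ^ n) +
      (secondSlope z₁ z₂)^[N] f z * ((z - z₁) ^ N * (z - z₂) ^ N) := by
  induction N with
  | zero => simp
  | succ N ih =>
    rw [Finset.sum_range_succ, Function.iterate_succ_apply']
    have := eq_add_secondSlope hne ((secondSlope z₁ z₂)^[N] f) z
    linear_combination ih + ((z - z₁) ^ N * (z - z₂) ^ N) * this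

/-! ### Cauchy integrals of the iterated divided differences. -/

namespace Contour

variable {C : Contour}

lemma Encircles.integral_inv_sub {a : ℂ} (h : C.Encircles a) :
    (C.integral fun w => 1 / (w - a)) = 2 * Real.pi * Complex.I := by
  rw [← windingNumber_mul, h.2, one_mul]

lemma continuousOn_inv_prod {s : Multiset ℂ} (h : ∀ a ∈ s, a ∉ C.trace) :
    ContinuousOn (fun w => 1 / (s.map fun a => w - a).prod) C.trace := by
  refine continuousOn_const.div (continuous_multiset_prod _ fun a _ => by fun_prop).continuousOn
    fun w hw => ?_
  rw [Ne, Multiset.prod_eq_zero_iff, Multiset.mem_map]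
  rintro ⟨a, ha, h0⟩
  exact h a ha (sub_eq_zero.1 h0 ▸ hw)

lemma integral_inv_pow_eq_zero {a : ℂ} (ha : a ∉ C.trace) (n : ℕ) :
    (C.integral fun w => 1 / (w - a) ^ (n + 2)) = 0 := by
  have h0 : ∀ w ∈ C.trace, w - a ≠ 0 := fun w hw => sub_ne_zero.2 (ne_of_mem_of_not_mem hw ha)
  refine integral_eq_zero_of_hasDerivAt
    (continuousOn_const.div (by fun_prop) fun w hw => pow_ne_zero _ (h0 w hw))
    (G := fun w => -1 / (n + 1) * (1 / (w - a) ^ (n + 1))) fun w hw => ?_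
  have hn : ((n : ℂ) + 1) ≠ 0 := Nat.cast_add_one_ne_zero n
  have hw0 := h0 w hw
  convert! ((hasDerivAt_const w (1 : ℂ)).fun_div (((hasDerivAt_id' w).sub_const a).fun_pow (n + 1))
    (pow_ne_zero _ hw0)).const_mul (-1 / (n + 1) : ℂ) using 1
  push_cast
  field_simp
  ring

/-- The integral of `1 / ∏ (w - a)` over a contour encircling all of at least two poles `a`
vanishes. -/
theorem integral_inv_prod_eq_zero {s : Multiset ℂ} (hs : 2 ≤ Multiset.card s)
    (h : ∀ a ∈ s, C.Encircles a) : (C.integral fun w => 1 / (s.map fun a => w - a).prod) = 0 := by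
  obtain ⟨n, hn⟩ := Nat.exists_eq_add_of_le' hs
  induction n generalizing s with
  | zero =>
    obtain ⟨a, b, rfl⟩ := Multiset.card_eq_two.1 hn
    have ha : C.Encircles a := h a (by simp)
    have hb : C.Encircles b := h b (by simp)
    rcases eq_or_ne a b with rfl | hab
    · simpa [pow_two] using integral_inv_pow_eq_zero ha.1 0
    have hab' := sub_ne_zero.2 hab
    -- Partial fractions: both simple poles have winding number 1, so their contributions cancel.
    rw [integral_congr (h := fun w => 1 / (a - b) * (1 / (w - a) - 1 / (w - b))) fun w hw => ?_,
      integral_const_mul, integral_sub (continuousOn_div_sub continuousOn_const ha.1)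
      (continuousOn_div_sub continuousOn_const hb.1), ha.integral_inv_sub, hb.integral_inv_sub,
      sub_self, mul_zero]
    have h1 := sub_ne_zero.2 (ne_of_mem_of_not_mem hw ha.1)
    have h2 := sub_ne_zero.2 (ne_of_mem_of_not_mem hw hb.1)
    simp
    field_simp
    ring
  | succ n ih =>
    have hpos : 0 < Multiset.card s := by omega
    obtain ⟨a, ha⟩ := Multiset.card_pos_iff_exists_mem.1 hpos
    -- A single multiple pole has a primitive. Otherwise partial fractions in two distinct poles a,
    -- b give two products with one factor fewer each.
    by_cases hall : ∀ b ∈ s, b = a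
    · rw [Multiset.eq_replicate_of_mem hall, hn]
      simp only [Multiset.map_replicate, Multiset.prod_replicate]
      exact integral_inv_pow_eq_zero (h a ha).1 (n + 1)
    push Not at hall
    obtain ⟨b, hb, hba⟩ := hall
    obtain ⟨t, rfl⟩ := Multiset.exists_cons_of_mem ha
    obtain ⟨t, rfl⟩ := Multiset.exists_cons_of_mem ((Multiset.mem_cons.1 hb).resolve_left hba)
    simp only [Multiset.card_cons] at hn
    have hat : ∀ c ∈ a ::ₘ t, C.Encircles c := fun c hc => h c (by
      simp only [Multiset.mem_cons] at hc ⊢; tauto)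
    have hbt : ∀ c ∈ b ::ₘ t, C.Encircles c := fun c hc => h c (by
      simp only [Multiset.mem_cons] at hc ⊢; tauto)
    have hab' := sub_ne_zero.2 hba.symm
    rw [integral_congr (h := fun w => 1 / (a - b) * (1 / ((a ::ₘ t).map fun c => w - c).prod -
      1 / ((b ::ₘ t).map fun c => w - c).prod)) fun w hw => ?_,
      integral_const_mul, integral_sub (continuousOn_inv_prod fun c hc => (hat c hc).1)
        (continuousOn_inv_prod fun c hc => (hbt c hc).1),
      ih (by simp only [Multiset.card_cons]; omega) hat (by simp only [Multiset.card_cons]; omega),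
      ih (by simp only [Multiset.card_cons]; omega) hbt (by simp only [Multiset.card_cons]; omega),
      sub_self, mul_zero]
    have h1 := sub_ne_zero.2 (ne_of_mem_of_not_mem hw (h a (by simp)).1)
    have h2 := sub_ne_zero.2 (ne_of_mem_of_not_mem hw (h b (by simp)).1)
    simp only [Multiset.map_cons, Multiset.prod_cons, one_div, mul_inv]
    generalize (Multiset.map (fun c => w - c) t).prod⁻¹ = P
    field_simp
    ring

variable {Ω : Set ℂ} {z₁ z₂ z : ℂ}

/-- The Cauchy integral for the iterated second divided differences. -/
theorem LiesInWithInside.integral_div_pow_mul_pow (hC : C.LiesInWithInside Ω) (hΩ : IsOpen Ω)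
    (hne : z₁ ≠ z₂) (h₁ : C.Encircles z₁) (h₂ : C.Encircles z₂) (h : C.Encircles z) (hz : z ∈ Ω)
    (N : ℕ) {f : ℂ → ℂ} (hf : DifferentiableOn ℂ f Ω) :
    (C.integral fun w => f w / ((w - z₁) ^ N * (w - z₂) ^ N * (w - z))) =
      2 * Real.pi * Complex.I * (secondSlope z₁ z₂)^[N] f z := by
  induction N generalizing f with
  | zero => simpa [h.2] using hC.integral_div_sub hΩ hf hz h.1
  | succ N ih =>
    have hD := hf.secondSlope hΩ z₁ z₂
    rw [Function.iterate_succ_apply, ← ih hD]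
    have h0 : ∀ {a}, C.Encircles a → ∀ w ∈ C.trace, w - a ≠ 0 := fun ha w hw =>
      sub_ne_zero.2 (ne_of_mem_of_not_mem hw ha.1)
    -- The poles, with multiplicity, left when the summands in w - z₁ and w - z₂ of the interpolant
    -- are divided by the denominator: `s` and `t` both have 2N + 2 elements.
    set s := Multiset.replicate N z₁ + Multiset.replicate (N + 1) z₂ + {z} with hs
    set t := Multiset.replicate (N + 1) z₁ + Multiset.replicate N z₂ + {z} with ht
    have hs' : ∀ a ∈ s, C.Encircles a := by
      intro a ha
      simp only [hs, Multiset.mem_add, Multiset.mem_replicate, Multiset.mem_singleton] at ha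
      rcases ha with (⟨-, rfl⟩ | ⟨-, rfl⟩) | rfl <;> assumption
    have ht' : ∀ a ∈ t, C.Encircles a := by
      intro a ha
      simp only [ht, Multiset.mem_add, Multiset.mem_replicate, Multiset.mem_singleton] at ha
      rcases ha with (⟨-, rfl⟩ | ⟨-, rfl⟩) | rfl <;> assumption
    have hcs := continuousOn_inv_prod fun a ha => (hs' a ha).1
    have hct := continuousOn_inv_prod fun a ha => (ht' a ha).1
    have hcD : ContinuousOn (fun w => secondSlope z₁ z₂ f w /
        ((w - z₁) ^ N * (w - z₂) ^ N * (w - z))) C.trace :=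
      (hD.continuousOn.mono hC.1).div (by fun_prop) fun w hw =>
        mul_ne_zero (mul_ne_zero (pow_ne_zero _ (h0 h₁ w hw)) (pow_ne_zero _ (h0 h₂ w hw)))
          (h0 h w hw)
    have hsplit := integral_add
      (g := fun w => f z₂ / (z₂ - z₁) * (1 / (s.map fun a => w - a).prod) +
        f z₁ / (z₁ - z₂) * (1 / (t.map fun a => w - a).prod))
      ((continuousOn_const.mul hcs).add (continuousOn_const.mul hct)) hcD
    rw [integral_add (g := fun w => f z₂ / (z₂ - z₁) * (1 / (s.map fun a => w - a).prod))
      (continuousOn_const.mul hcs)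
      (h := fun w => f z₁ / (z₁ - z₂) * (1 / (t.map fun a => w - a).prod))
      (continuousOn_const.mul hct), integral_const_mul, integral_const_mul,
      integral_inv_prod_eq_zero (by simp [hs]) hs',
      integral_inv_prod_eq_zero (by simp [ht]) ht', mul_zero, mul_zero, zero_add,
      zero_add] at hsplit
    rw [← hsplit]
    refine integral_congr fun w hw => ?_
    have hw1 := h0 h₁ w hw
    have hw2 := h0 h₂ w hw
    have hw3 := h0 h w hw
    simp only [hs, ht, Multiset.map_add, Multiset.prod_add, Multiset.map_replicate,
      Multiset.prod_replicate, Multiset.map_singleton, Multiset.prod_singleton]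
    nth_rewrite 1 [eq_add_secondSlope hne f w]
    generalize f z₂ / (z₂ - z₁) = α
    generalize f z₁ / (z₁ - z₂) = β
    field_simp
    ring

end Contour

/-! ### Even and odd parts, and Taylor series by iterated difference quotients. -/

/-- An even holomorphic function is a holomorphic function of the square of the variable. -/
theorem exists_differentiableOn_eq_comp_sq {D : Set ℂ} (hD : IsOpen D) {G : ℂ → ℂ}
    (hG : DifferentiableOn ℂ G {u | u ^ 2 ∈ D}) (heven : ∀ u, u ^ 2 ∈ D → G (-u) = G u) :
    ∃ e : ℂ → ℂ, DifferentiableOn ℂ e D ∧ ∀ u, u ^ 2 ∈ D → G u = e (u ^ 2) := by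
  have hV : IsOpen {u : ℂ | u ^ 2 ∈ D} := hD.preimage (continuous_pow 2)
  -- The principal root jumps across its cut, but evenness makes G ∘ σ independent of the choice of
  -- root.
  set σ : ℂ → ℂ := fun v => v ^ (((2 : ℕ) : ℂ)⁻¹) with hσ
  have hsq : ∀ v, σ v ^ 2 = v := fun v => Complex.cpow_nat_inv_pow v two_ne_zero
  have hG' : ∀ u u', u ^ 2 = u' ^ 2 → u' ^ 2 ∈ D → G u = G u' := by
    intro u u' h hu'
    rcases sq_eq_sq_iff_eq_or_eq_neg.1 h with rfl | rfl
    · rfl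
    · exact heven u' hu'
  have hne : ∀ v₀ ∈ D, v₀ ≠ 0 → DifferentiableAt ℂ (fun v => G (σ v)) v₀ := by
    intro v₀ hv₀ h0
    -- A branch of the root holomorphic near v₀, since v / v₀ is near 1 there.
    have hτ : DifferentiableAt ℂ (fun v => σ v₀ * σ (v / v₀)) v₀ := by
      refine DifferentiableAt.const_mul (DifferentiableAt.cpow_const (by fun_prop) ?_) _
      rw [div_self h0]
      exact Complex.one_mem_slitPlane
    have hτsq : ∀ v, (σ v₀ * σ (v / v₀)) ^ 2 = v := fun v => by
      rw [mul_pow, hsq, hsq, mul_div_cancel₀ _ h0]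
    have hmem : (σ v₀ * σ (v₀ / v₀)) ∈ {u : ℂ | u ^ 2 ∈ D} := by
      rw [mem_ofPred_eq, hτsq]
      exact hv₀
    refine ((hG.differentiableAt (hV.mem_nhds hmem)).comp v₀ hτ).congr_of_eventuallyEq ?_
    filter_upwards [hD.mem_nhds hv₀] with v hv
    exact hG' _ _ (by rw [hsq, hτsq]) (by rwa [hτsq])
  refine ⟨fun v => G (σ v), ?_, fun u hu => (hG' _ _ (hsq _) hu).symm⟩
  by_cases h0 : (0 : ℂ) ∈ D
  · refine (Complex.differentiableOn_compl_singleton_and_continuousAt_iff (hD.mem_nhds h0)).1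
      ⟨fun v hv => (hne v hv.1 hv.2).differentiableWithinAt, ?_⟩
    have hσ0 : σ 0 = 0 := by simpa using hsq 0
    have hσc : Tendsto σ (𝓝 0) (𝓝 (σ 0)) := by
      rw [hσ0, tendsto_zero_iff_norm_tendsto_zero]
      have : ∀ v, ‖σ v‖ = √‖v‖ := fun v => by
        rw [← Real.sqrt_sq (norm_nonneg (σ v)), ← norm_pow, hsq]
      simp only [this]
      have h : Continuous fun v : ℂ => √‖v‖ := by fun_prop
      simpa using h.tendsto 0
    have hGc : ContinuousAt G (σ 0) := by
      refine (hG.differentiableAt (hV.mem_nhds ?_)).continuousAt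
      rw [mem_ofPred_eq, hsq]
      exact h0
    exact hGc.tendsto.comp hσc
  · exact fun v hv => (hne v hv fun h => h0 (h ▸ hv)).differentiableWithinAt

/-- The even and odd parts of a holomorphic function, in terms of the square of the variable. -/
theorem exists_differentiableOn_eq_even_add_odd {D : Set ℂ} (hD : IsOpen D) {F : ℂ → ℂ}
    (hF : DifferentiableOn ℂ F {u | u ^ 2 ∈ D}) :
    ∃ e o : ℂ → ℂ, DifferentiableOn ℂ e D ∧ DifferentiableOn ℂ o D ∧
      ∀ u, u ^ 2 ∈ D → F u = e (u ^ 2) + u * o (u ^ 2) := by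
  have hV : IsOpen {u : ℂ | u ^ 2 ∈ D} := hD.preimage (continuous_pow 2)
  have hFneg : DifferentiableOn ℂ (fun u => F (-u)) {u | u ^ 2 ∈ D} :=
    hF.comp (by fun_prop) fun u hu => by simpa using hu
  have hodd : DifferentiableOn ℂ (fun u => (F u - F (-u)) / 2) {u | u ^ 2 ∈ D} :=
    (hF.sub hFneg).div_const 2
  obtain ⟨e, he, hFe⟩ := exists_differentiableOn_eq_comp_sq hD
    (G := fun u => (F u + F (-u)) / 2) ((hF.add hFneg).div_const 2)
    fun u _ => by simp only [neg_neg]; ring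
  -- The odd part divided by u is even; `dslope` at 0 supplies the value at u = 0.
  obtain ⟨o, ho, hFo⟩ := exists_differentiableOn_eq_comp_sq hD
    (G := dslope (fun u => (F u - F (-u)) / 2) 0) (hodd.dslope hV) fun u _ => by
      rcases eq_or_ne u 0 with rfl | hu
      · simp
      · rw [dslope_of_ne _ (neg_ne_zero.2 hu), dslope_of_ne _ hu, slope_def_field, slope_def_field]
        simp only [neg_neg, neg_zero, sub_zero, sub_self]
        field_simp
        ring
  refine ⟨e, o, he, ho, fun u hu => ?_⟩
  have h := sub_smul_dslope (fun u => (F u - F (-u)) / 2) 0 u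
  simp only [neg_zero, sub_zero, sub_self, zero_div, smul_eq_mul] at h
  rw [← hFe u hu, ← hFo u hu, h]
  ring

lemma DifferentiableOn.iterate_dslope {Ω : Set ℂ} (hΩ : IsOpen Ω) {g : ℂ → ℂ}
    (hg : DifferentiableOn ℂ g Ω) (a : ℂ) (n : ℕ) :
    DifferentiableOn ℂ ((Function.swap _root_.dslope a)^[n] g) Ω := by
  induction n with
  | zero => exact hg
  | succ n ih =>
    rw [Function.iterate_succ_apply']
    exact ih.dslope hΩ

/-- Taylor's formula, the coefficients being iterated difference quotients. -/
lemma hasSum_iterate_dslope {x v : ℂ} {R : ℝ} {e : ℂ → ℂ}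
    (he : DifferentiableOn ℂ e (Metric.ball x R)) (hv : v ∈ Metric.ball x R) :
    HasSum (fun n : ℕ => (Function.swap dslope x)^[n] e x * (v - x) ^ n) (e v) := by
  obtain ⟨r, hvr, hrR⟩ := exists_between (Metric.mem_ball.1 hv)
  have hr : 0 < r := dist_nonneg.trans_lt hvr
  lift r to NNReal using hr.le
  have hp := (he.mono (Metric.closedBall_subset_ball hrR)).hasFPowerSeriesOnBall
    (NNReal.coe_pos.1 hr)
  have hmem : v ∈ Metric.eball x (r : ℝ≥0∞) := by
    rw [Metric.eball_coe]
    exact hvr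
  refine (hp.hasSum_sub hmem).congr_fun fun n => ?_
  -- Each difference quotient shifts the power series by one, so the n-th Taylor coefficient is the
  -- constant term of the n-th iterate.
  have hc := (hp.hasFPowerSeriesAt.has_fpower_series_iterate_dslope_fslope n).coeff_zero 1
  rw [← hc, FormalMultilinearSeries.apply_eq_prod_smul_coeff,
    FormalMultilinearSeries.apply_eq_prod_smul_coeff, FormalMultilinearSeries.coeff_iterate_fslope]
  simp [mul_comm]

/-! ### Convergence inside Cassini ovals. -/

section Cassini

variable {z₁ z₂ : ℂ}

lemma sq_sub_center (z₁ z₂ w : ℂ) :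
    (w - (z₁ + z₂) / 2) ^ 2 - ((z₁ - z₂) / 2) ^ 2 = (w - z₁) * (w - z₂) := by
  ring

lemma sq_sub_center_mem_ball {w : ℂ} {R : ℝ} :
    (w - (z₁ + z₂) / 2) ^ 2 ∈ Metric.ball (((z₁ - z₂) / 2) ^ 2) R ↔
      ‖(w - z₁) * (w - z₂)‖ < R := by
  rw [mem_ball_iff_norm, sq_sub_center]

/-- At both z₁ and z₂ the square u² equals d², so freezing e and o at d² gives a polynomial of
degree at most 1 in w with the values of g at z₁ and z₂; the interpolant is unique. -/
lemma eq_linear_of_eq_even_add_odd (hne : z₁ ≠ z₂) {g e o : ℂ → ℂ}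
    (hg : ∀ w, (w - z₁) * (w - z₂) = 0 → g w = e ((w - (z₁ + z₂) / 2) ^ 2) +
      (w - (z₁ + z₂) / 2) * o ((w - (z₁ + z₂) / 2) ^ 2)) (w : ℂ) :
    g z₂ / (z₂ - z₁) * (w - z₁) + g z₁ / (z₁ - z₂) * (w - z₂) =
      e (((z₁ - z₂) / 2) ^ 2) + (w - (z₁ + z₂) / 2) * o (((z₁ - z₂) / 2) ^ 2) := by
  have h₁ := hg z₁ (by simp)
  have h₂ := hg z₂ (by simp)
  have e₁ : (z₁ - (z₁ + z₂) / 2) ^ 2 = ((z₁ - z₂) / 2) ^ 2 := by ring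
  have e₂ : (z₂ - (z₁ + z₂) / 2) ^ 2 = ((z₁ - z₂) / 2) ^ 2 := by ring
  rw [e₁] at h₁
  rw [e₂] at h₂
  rw [h₁, h₂]
  have h12 : z₁ - z₂ ≠ 0 := sub_ne_zero.2 hne
  rw [← neg_sub z₁ z₂]
  field_simp
  ring

/-- Subtracting the interpolant from g leaves e(u²) - e(d²) + u (o(u²) - o(d²)), and dividing by q =
u² - d² turns both differences into difference quotients at d². -/
lemma secondSlope_eq_even_add_odd (hne : z₁ ≠ z₂) {Ω : Set ℂ} (hΩ : IsOpen Ω) {R : ℝ}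
    (hR : ∀ w, ‖(w - z₁) * (w - z₂)‖ < R → w ∈ Ω) {g e o : ℂ → ℂ}
    (hgd : DifferentiableOn ℂ g Ω)
    (he : DifferentiableOn ℂ e (Metric.ball (((z₁ - z₂) / 2) ^ 2) R))
    (ho : DifferentiableOn ℂ o (Metric.ball (((z₁ - z₂) / 2) ^ 2) R))
    (hg : ∀ w, ‖(w - z₁) * (w - z₂)‖ < R → g w = e ((w - (z₁ + z₂) / 2) ^ 2) +
      (w - (z₁ + z₂) / 2) * o ((w - (z₁ + z₂) / 2) ^ 2)) (w : ℂ)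
    (hw : ‖(w - z₁) * (w - z₂)‖ < R) :
    secondSlope z₁ z₂ g w = dslope e (((z₁ - z₂) / 2) ^ 2) ((w - (z₁ + z₂) / 2) ^ 2) +
      (w - (z₁ + z₂) / 2) * dslope o (((z₁ - z₂) / 2) ^ 2) ((w - (z₁ + z₂) / 2) ^ 2) := by
  have hR0 : 0 < R := (norm_nonneg _).trans_lt hw
  have hU : IsOpen {w : ℂ | ‖(w - z₁) * (w - z₂)‖ < R} :=
    isOpen_lt (by fun_prop) continuous_const
  have hq : ContinuousAt (fun w : ℂ => (w - (z₁ + z₂) / 2) ^ 2) w := by fun_prop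
  have hball := Metric.isOpen_ball.mem_nhds (sq_sub_center_mem_ball.2 hw)
  have hce := ((he.dslope Metric.isOpen_ball (a := ((z₁ - z₂) / 2) ^ 2)).differentiableAt
    hball).continuousAt
  have hco := ((ho.dslope Metric.isOpen_ball (a := ((z₁ - z₂) / 2) ^ 2)).differentiableAt
    hball).continuousAt
  have hcl : ContinuousAt (secondSlope z₁ z₂ g) w :=
    ((hgd.secondSlope hΩ z₁ z₂).differentiableAt (hΩ.mem_nhds (hR w hw))).continuousAt
  have hcr : ContinuousAt (fun w => dslope e (((z₁ - z₂) / 2) ^ 2) ((w - (z₁ + z₂) / 2) ^ 2) +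
      (w - (z₁ + z₂) / 2) * dslope o (((z₁ - z₂) / 2) ^ 2) ((w - (z₁ + z₂) / 2) ^ 2)) w :=
    (ContinuousAt.comp' (f := fun w : ℂ => (w - (z₁ + z₂) / 2) ^ 2) hce hq).add
      (ContinuousAt.mul (by fun_prop)
        (ContinuousAt.comp' (f := fun w : ℂ => (w - (z₁ + z₂) / 2) ^ 2) hco hq))
  -- The factor q can be cancelled only away from z₁ and z₂; continuity of both sides covers these
  -- two points.
  refine ((hcl.eventuallyEq_nhds_iff_eventuallyEq_nhdsNE hcr).1 ?_).eq_of_nhds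
  have hfin : ∀ a, ∀ᶠ x in 𝓝[≠] w, x ≠ a := by
    intro a
    rcases eq_or_ne w a with rfl | ha
    · exact eventually_mem_nhdsWithin
    · exact (eventually_ne_nhds ha).filter_mono nhdsWithin_le_nhds
  filter_upwards [hfin z₁, hfin z₂, mem_nhdsWithin_of_mem_nhds (hU.mem_nhds hw)] with x hx₁ hx₂ hxR
  have h1 := eq_add_secondSlope hne g x
  have h2 := sub_smul_dslope e (((z₁ - z₂) / 2) ^ 2) ((x - (z₁ + z₂) / 2) ^ 2)
  have h3 := sub_smul_dslope o (((z₁ - z₂) / 2) ^ 2) ((x - (z₁ + z₂) / 2) ^ 2)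
  have h4 := hg x hxR
  rw [eq_linear_of_eq_even_add_odd hne (e := e) (o := o)
    (fun w hw0 => hg w (by rw [hw0, norm_zero]; exact hR0)) x] at h1
  rw [sq_sub_center, smul_eq_mul] at h2 h3
  refine mul_left_cancel₀ (mul_ne_zero (sub_ne_zero.2 hx₁) (sub_ne_zero.2 hx₂)) ?_
  linear_combination h4 - h1 - h2 - (x - (z₁ + z₂) / 2) * h3

/-- The two-point expansion converges on the lemniscate domains contained in `Ω`. -/
theorem hasSum_secondSlope (hne : z₁ ≠ z₂) {Ω : Set ℂ} (hΩ : IsOpen Ω) {R : ℝ}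
    (hR : ∀ w, ‖(w - z₁) * (w - z₂)‖ < R → w ∈ Ω) {f : ℂ → ℂ} (hf : DifferentiableOn ℂ f Ω)
    {z : ℂ} (hz : ‖(z - z₁) * (z - z₂)‖ < R) :
    HasSum (fun n : ℕ =>
      ((secondSlope z₁ z₂)^[n] f z₂ / (z₂ - z₁) * (z - z₁) +
        (secondSlope z₁ z₂)^[n] f z₁ / (z₁ - z₂) * (z - z₂)) *
          ((z - z₁) ^ n * (z - z₂) ^ n)) (f z) := by
  have hR0 : 0 < R := (norm_nonneg _).trans_lt hz
  obtain ⟨e, o, he, ho, hfeo⟩ := exists_differentiableOn_eq_even_add_odd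
    (D := Metric.ball (((z₁ - z₂) / 2) ^ 2) R) Metric.isOpen_ball
    (F := fun u => f (u + (z₁ + z₂) / 2)) (hf.comp (by fun_prop) fun u hu => hR _ (by
      rw [← sq_sub_center_mem_ball, add_sub_cancel_right]
      exact hu))
  have key : ∀ n : ℕ, DifferentiableOn ℂ ((secondSlope z₁ z₂)^[n] f) Ω ∧
      ∀ w, ‖(w - z₁) * (w - z₂)‖ < R → (secondSlope z₁ z₂)^[n] f w =
        (Function.swap dslope (((z₁ - z₂) / 2) ^ 2))^[n] e ((w - (z₁ + z₂) / 2) ^ 2) +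
        (w - (z₁ + z₂) / 2) *
          (Function.swap dslope (((z₁ - z₂) / 2) ^ 2))^[n] o ((w - (z₁ + z₂) / 2) ^ 2) := by
    intro n
    induction n with
    | zero =>
      refine ⟨hf, fun w hw => ?_⟩
      simpa using hfeo (w - (z₁ + z₂) / 2) (sq_sub_center_mem_ball.2 hw)
    | succ n ih =>
      simp only [Function.iterate_succ_apply']
      exact ⟨ih.1.secondSlope hΩ z₁ z₂, secondSlope_eq_even_add_odd hne hΩ hR ih.1
        (he.iterate_dslope Metric.isOpen_ball _ n) (ho.iterate_dslope Metric.isOpen_ball _ n)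
        ih.2⟩
  have hzb := sq_sub_center_mem_ball.2 hz
  have hsum := (hasSum_iterate_dslope he hzb).add
    ((hasSum_iterate_dslope ho hzb).mul_left (z - (z₁ + z₂) / 2))
  have hfz := (key 0).2 z hz
  simp only [Function.iterate_zero, id] at hfz
  rw [← hfz] at hsum
  refine hsum.congr_fun fun n => ?_
  -- The n-th interpolant, evaluated at z and multiplied by q(z)ⁿ, is the n-th Taylor term of e plus
  -- u times that of o.
  rw [eq_linear_of_eq_even_add_odd hne (fun w hw0 => (key n).2 w (by rwa [hw0, norm_zero])) z,
    sq_sub_center, mul_pow]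
  ring

end Cassini

/-- A real R strictly below the possibly infinite Cassini parameter gives a full set |q| < R inside
Ω, as the even-odd splitting requires. -/
lemma exists_lt_forall_mem_of_mem_cassiniOval {Ω : Set ℂ} {z₁ z₂ z : ℂ}
    (hz : z ∈ cassiniOval Ω z₁ z₂) : ∃ R : ℝ, ‖(z - z₁) * (z - z₂)‖ < R ∧
      ∀ w, ‖(w - z₁) * (w - z₂)‖ < R → w ∈ Ω := by
  obtain ⟨R, hzR, hR⟩ := ENNReal.lt_iff_exists_nnreal_btwn.1 hz.2
  refine ⟨R, NNReal.coe_lt_coe.2 (enorm_lt_coe.1 hzR), fun w hw => ?_⟩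
  by_contra hwΩ
  have h1 : cassiniParameter Ω z₁ z₂ ≤ ‖(w - z₁) * (w - z₂)‖ₑ := iInf₂_le w hwΩ
  exact ((hR.trans_le h1).trans (enorm_lt_coe.2 (NNReal.coe_lt_coe.1 hw))).false

theorem theorem1 (Ω : Set ℂ) (hΩ : IsOpen Ω) (f : ℂ → ℂ) (hf : AnalyticOnNhd ℂ f Ω)
    (z₁ z₂ : ℂ) (hz₁ : z₁ ∈ Ω) (hz₂ : z₂ ∈ Ω) (hne : z₁ ≠ z₂) :
    -- there are contours of the kind used below
    (∀ z ∈ Ω, ∃ C : Contour, C.LiesInWithInside Ω ∧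
      C.Encircles z₁ ∧ C.Encircles z₂ ∧ C.Encircles z) ∧
    -- `a n` is `aₙ(z₁, z₂)` and `b n` is `aₙ(z₂, z₁)`
    ∃ a b : ℕ → ℂ,
      (∀ C : Contour, C.LiesInWithInside Ω → C.Encircles z₁ → C.Encircles z₂ →
        ∀ n, a n = twoPointCoeff f C z₁ z₂ n ∧ b n = twoPointCoeff f C z₂ z₁ n) ∧
      (∀ z ∈ Ω, ∀ C : Contour, C.LiesInWithInside Ω →
        C.Encircles z₁ → C.Encircles z₂ → C.Encircles z →
        ∀ N : ℕ, f z =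
          ∑ n ∈ Finset.range N,
            (a n * (z - z₁) + b n * (z - z₂)) * ((z - z₁) ^ n * (z - z₂) ^ n) +
          twoPointRemainder f C z₁ z₂ N z) ∧
      (∀ z ∈ cassiniOval Ω z₁ z₂,
        HasSum (fun n : ℕ =>
          (a n * (z - z₁) + b n * (z - z₂)) * ((z - z₁) ^ n * (z - z₂) ^ n)) (f z)) ∧
      (Ω = Set.univ → ∀ z : ℂ,
        HasSum (fun n : ℕ =>
          (a n * (z - z₁) + b n * (z - z₂)) * ((z - z₁) ^ n * (z - z₂) ^ n)) (f z)) := by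
  have hfd := hf.differentiableOn
  have hpi := Complex.two_pi_I_ne_zero
  have h12 := sub_ne_zero.2 hne
  have h21 := sub_ne_zero.2 hne.symm
  refine ⟨fun z hz => ?_, fun n => (secondSlope z₁ z₂)^[n] f z₂ / (z₂ - z₁),
    fun n => (secondSlope z₁ z₂)^[n] f z₁ / (z₁ - z₂), fun C hC h₁ h₂ n => ⟨?_, ?_⟩,
    fun z hz C hC h₁ h₂ h N => ?_, fun z hz => ?_, ?_⟩
  -- As a `Finset` this lists each point once, so no circle is doubled when z is z₁ or z₂.
  · obtain ⟨C, hC, h⟩ := Contour.exists_encircles hΩ {z₁, z₂, z} (by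
      simp [Set.insert_subset_iff, hz₁, hz₂, hz])
    exact ⟨C, hC, h _ (by simp), h _ (by simp), h _ (by simp)⟩
  -- With z = z₂ the remainder integral of order n becomes the coefficient integral.
  · have key := hC.integral_div_pow_mul_pow hΩ hne h₁ h₂ h₂ hz₂ n hfd
    simp only [mul_assoc ((_ : ℂ) ^ n), ← pow_succ] at key
    rw [twoPointCoeff, key]
    field_simp
  · have key := hC.integral_div_pow_mul_pow hΩ hne h₁ h₂ h₁ hz₁ n hfd
    have hcomm : (fun w => f w / ((w - z₂) ^ n * (w - z₁) ^ (n + 1))) =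
        fun w => f w / ((w - z₁) ^ n * (w - z₂) ^ n * (w - z₁)) := by
      funext w
      congr 1
      ring
    rw [twoPointCoeff, hcomm, key]
    field_simp
  · rw [twoPointRemainder, hC.integral_div_pow_mul_pow hΩ hne h₁ h₂ h hz N hfd,
      one_div, inv_mul_cancel_left₀ hpi]
    exact eq_sum_add_iterate_secondSlope hne f N z
  · obtain ⟨R, hzR, hR⟩ := exists_lt_forall_mem_of_mem_cassiniOval hz
    exact hasSum_secondSlope hne hΩ hR hfd hzR
  · rintro rfl z
    exact hasSum_secondSlope hne hΩ (fun _ _ => mem_univ _) hfd (lt_add_one _)
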